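/- Let $n,m\in\mathbb{N}$, let $b_{ij}\ge 0$ ($i\le n$, $j\le m$) be arbitrary scalars, and let $\xi_{ij}$ ($i\le n$, $j\le m$) be independent symmetrically distributed real random variables with $\mathbf{E}[\xi_{ij}^{2k}]\le\mathbf{E}[g^{2k}]$ for all $i,j$ and all $k\in\mathbb{N}$, where $g\sim N(0,1)$. Let $X$ be the $n\times m$ random matrix with entries $X_{ij}=b_{ij}\xi_{ij}$, and define $$\sigma_1^2:=\max_{j\le m}\sum_{i\le n}b_{ij}^2,\qquad \sigma_2^2:=\max_{i\le n}\sum_{j\le m}b_{ij}^2,\qquad \sigma_*^2:=\max_{i\le n,\,j\le m}b_{ij}^2.$$ Assume that $\sigma_*^2=1$, and that $\sigma_1^2\le d_1$ and $\sigma_2^2\le d_2$ with $d_1,d_2\in\mathbb{N}$. Let $Y$ be a $d_1\times d_2$ random matrix with independent entries $Y_{ij}\sim N(0,1)$. Then, for every $p\in\mathbb{N}$, the random variables $\operatorname{tr}(XX^*)^p$ and $\operatorname{tr}(YY^*)^p$ are integrable and $$\mathbf{E}[\operatorname{tr}(XX^*)^p]\le\mathbf{E}[\operatorname{tr}(YY^*)^p],$$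 where $\operatorname{tr}M:=\frac1k\operatorname{Tr}M$ denotes the normalized trace of a $k\times k$ matrix $M$. -/

import Mathlib

open MeasureTheory ProbabilityTheory
open scoped Matrix

namespace RectExtremum

noncomputable section

/-- `σ₁² = max_{j ≤ m} ∑_{i ≤ n} b_{ij}²` (the value is `0` for an empty family). -/
def sigmaOneSq {n m : ℕ} (b : Matrix (Fin n) (Fin m) ℝ) : ℝ :=
  ⨆ j : Fin m, ∑ i : Fin n, b i j ^ 2

/-- `σ₂² = max_{i ≤ n} ∑_{j ≤ m} b_{ij}²` (the value is `0` for an empty family). -/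
def sigmaTwoSq {n m : ℕ} (b : Matrix (Fin n) (Fin m) ℝ) : ℝ :=
  ⨆ i : Fin n, ∑ j : Fin m, b i j ^ 2

/-- `σ_*² = max_{i ≤ n, j ≤ m} b_{ij}²` (the value is `0` for an empty family). -/
def sigmaStarSq {n m : ℕ} (b : Matrix (Fin n) (Fin m) ℝ) : ℝ :=
  ⨆ q : Fin n × Fin m, b q.1 q.2 ^ 2

/-- The normalized trace `tr M = (1/n) Tr M` of an `n × n` matrix. -/
def normTrace {n : ℕ} (M : Matrix (Fin n) (Fin n) ℝ) : ℝ :=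
  (1 / (n : ℝ)) * M.trace

/-- `X` is an `n × m` random matrix with entries `X_{ij} = b_{ij} ξ_{ij}`, where the `b_{ij} ≥ 0`
are scalars and the `ξ_{ij}` are independent, symmetrically distributed real random variables
all of whose even moments are dominated by those of `g ∼ N(0,1)`. -/
structure IsIndependentEntryModel {n m : ℕ} {Ω : Type*} [MeasurableSpace Ω]
    (μ : Measure Ω) (b : Matrix (Fin n) (Fin m) ℝ) (ξ : Fin n → Fin m → Ω → ℝ)
    (X : Ω → Matrix (Fin n) (Fin m) ℝ) : Prop where
  entry_eq : ∀ ω i j, X ω i j = b i j * ξ i j ω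
  scalar_nonneg : ∀ i j, 0 ≤ b i j
  aemeasurable : ∀ i j, AEMeasurable (ξ i j) μ
  indep : iIndepFun (fun q : Fin n × Fin m => ξ q.1 q.2) μ
  symm_law : ∀ i j, μ.map (fun ω => -ξ i j ω) = μ.map (ξ i j)
  /-- The moments are finite, so that the next field compares true expectations. -/
  moment_integrable : ∀ i j (k : ℕ), Integrable (fun ω => ξ i j ω ^ (2 * k)) μ
  moment_le : ∀ i j (k : ℕ),
    ∫ ω, ξ i j ω ^ (2 * k) ∂μ ≤ ∫ x, x ^ (2 * k) ∂(gaussianReal 0 1)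

/-- `Y` is a `d₁ × d₂` random matrix with independent `N(0,1)` entries. -/
structure IsStandardGaussianMatrix {d₁ d₂ : ℕ} {Ω : Type*} [MeasurableSpace Ω]
    (μ : Measure Ω) (Y : Ω → Matrix (Fin d₁) (Fin d₂) ℝ) : Prop where
  law : ∀ i j, HasLaw (fun ω => Y ω i j) (gaussianReal 0 1) μ
  indep : iIndepFun (fun (q : Fin d₁ × Fin d₂) (ω : Ω) => Y ω q.1 q.2) μ

end

end RectExtremum

/-! ### Pairings and Gaussian moments. -/

namespace RectExtremum

open Equiv Finset
open scoped Nat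

/-! Expanding `Tr (XXᴴ)^p` gives closed walks alternating between rows and columns, with `2p` edges.
By independence, the expectation of a walk's product factors over distinct entries. Odd moments
vanish by symmetry, and even ones are at most the Gaussian moments, which count pairings. So `E Tr
(XXᴴ)^p` is at most a sum of `pairingSum b π` over pairings `π` of the edges, with equality for a
Gaussian matrix and unit weights.

It remains to compare the sums for each fixed `π`. Gluing the walk along `π` leaves a connected
bipartite graph with vertex classes `V₁`, `V₂`, whose vertices are coloured by indices
(`pairingSum_eq_sum_quot`). Grow a spanning tree along the walk. A tree edge and its partner carry
the same weight, hence a factor `b²`; all other weights are at most 1. Summing out leaves costs `d₁`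
per row vertex and `d₂` per column vertex, except for the root, which costs `n`. The total `n
d₁^(|V₁|-1) d₂^|V₂|` is `n / d₁` times the value for the all-ones `d₁ × d₂` matrix, and normalizing
the traces removes this ratio. -/

/-- The fixed-point-free involutions of `E`, i.e. the pairings of the elements of `E`. -/
def pairings (E : Type*) [Fintype E] [DecidableEq E] : Finset (Perm E) :=
  {σ | (∀ x, σ (σ x) = x) ∧ ∀ x, σ x ≠ x}

lemma mem_pairings {E : Type*} [Fintype E] [DecidableEq E] {σ : Perm E} :
    σ ∈ pairings E ↔ (∀ x, σ (σ x) = x) ∧ ∀ x, σ x ≠ x := by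
  simp [pairings]

lemma cycleType_of_mem_pairings {E : Type*} [Fintype E] [DecidableEq E] {σ : Perm E}
    (h : σ ∈ pairings E) :
    ∃ k, Fintype.card E = 2 * k ∧ σ.cycleType = Multiset.replicate k 2 := by
  obtain ⟨h1, h2⟩ := mem_pairings.1 h
  have hsq : σ ^ 2 = 1 := by ext x; simp [pow_two, h1]
  have hrep : σ.cycleType = Multiset.replicate (Multiset.card σ.cycleType) 2 := by
    rw [Multiset.eq_replicate_card]
    intro c hc
    have hd : c ∣ 2 := (Perm.dvd_of_mem_cycleType hc).trans (orderOf_dvd_of_pow_eq_one hsq)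
    exact le_antisymm (Nat.le_of_dvd two_pos hd) (Perm.two_le_of_mem_cycleType hc)
  refine ⟨_, ?_, hrep⟩
  have hs : σ.support = univ := by ext x; simp [h2]
  have := σ.sum_cycleType
  rw [hs, hrep] at this
  simp at this
  omega

lemma mem_pairings_of_cycleType {E : Type*} [Fintype E] [DecidableEq E] {σ : Perm E} {k : ℕ}
    (hk : Fintype.card E = 2 * k) (h : σ.cycleType = Multiset.replicate k 2) :
    σ ∈ pairings E := by
  rw [mem_pairings]
  constructor
  · have : orderOf σ ∣ 2 := by
      rw [← Perm.lcm_cycleType, h, Multiset.lcm_dvd]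
      intro b hb
      rw [Multiset.eq_of_mem_replicate hb]
    intro x
    have h2 := orderOf_dvd_iff_pow_eq_one.1 this
    rw [← Perm.mul_apply, ← pow_two, h2, Perm.one_apply]
  · have hs := σ.sum_cycleType
    rw [h] at hs
    have : σ.support = univ := by
      rw [← card_eq_iff_eq_univ, ← hs, hk, Multiset.sum_replicate, smul_eq_mul, mul_comm]
    intro x
    rw [← Perm.mem_support, this]
    exact mem_univ x

/-- Pairings form a single conjugacy class of permutations, so the class-size formula counts them.
-/
lemma card_pairings_even {E : Type*} [Fintype E] [DecidableEq E] {k : ℕ}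
    (hk : Fintype.card E = 2 * k) : #(pairings E) * (2 ^ k * k !) = (2 * k)! := by
  have hE : pairings E = univ.filter fun σ : Perm E => σ.cycleType = Multiset.replicate k 2 := by
    ext σ
    simp only [mem_filter, mem_univ, true_and]
    refine ⟨fun h => ?_, mem_pairings_of_cycleType hk⟩
    obtain ⟨l, hl, h⟩ := cycleType_of_mem_pairings h
    rwa [show k = l by omega]
  have := Perm.card_of_cycleType_mul_eq E (Multiset.replicate k 2)
  rw [← hE, if_pos, hk] at this
  · rw [← this]
    rcases Nat.eq_zero_or_pos k with rfl | hpos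
    · simp
    · rw [Multiset.toFinset_replicate, if_neg hpos.ne']
      simp [mul_comm k 2]
  · refine ⟨by simp [hk, mul_comm], fun a ha => ?_⟩
    rw [Multiset.eq_of_mem_replicate ha]

lemma card_pairings_odd {E : Type*} [Fintype E] [DecidableEq E] (hk : Odd (Fintype.card E)) :
    #(pairings E) = 0 := by
  rw [card_eq_zero, eq_empty_iff_forall_notMem]
  intro σ h
  obtain ⟨l, hl, -⟩ := cycleType_of_mem_pairings h
  rw [hl] at hk
  exact (Nat.not_odd_iff_even.2 (even_two_mul l)) hk

/-- The even moments of a standard Gaussian. -/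
lemma integral_pow_two_mul_gaussianReal (k : ℕ) :
    ∫ x, x ^ (2 * k) ∂(gaussianReal 0 1) = (2 * k)! / (2 ^ k * k !) := by
  rw [integral_gaussianReal_eq_integral_smul one_ne_zero]
  have h1 : ∀ x : ℝ, gaussianPDFReal 0 1 x • x ^ (2 * k) =
      (√(2 * Real.pi))⁻¹ * (fun y : ℝ => y ^ (2 * k : ℝ) * Real.exp (-(1/2) * y ^ (2:ℝ))) |x| := by
    intro x
    have : |x| ^ (2 * k : ℝ) = x ^ (2 * k) := by
      rw [show (2 * k : ℝ) = ((2 * k : ℕ) : ℝ) by push_cast; rfl, Real.rpow_natCast, pow_mul, sq_abs,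
        ← pow_mul]
    simp only [gaussianPDFReal, smul_eq_mul, this, Real.rpow_two, sq_abs]
    rw [show -(x - 0) ^ 2 / (2 * ((1 : NNReal) : ℝ)) = -(1/2) * x ^ 2 by simp; ring]
    simp
    ring
  simp_rw [h1]
  rw [integral_const_mul,
    integral_comp_abs (f := fun y : ℝ => y ^ (2 * k : ℝ) * Real.exp (-(1/2) * y ^ (2:ℝ))),
    integral_rpow_mul_exp_neg_mul_rpow two_pos (by linarith [k.cast_nonneg (α := ℝ)])
      (by norm_num)]
  rw [show (2 * k + 1 : ℝ) / 2 = k + 1 / 2 by ring, Real.Gamma_nat_add_half,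
    show -(2 * k + 1 : ℝ) / 2 = -(k + 1 / 2) by ring, one_div, Real.inv_rpow two_pos.le,
    Real.rpow_neg two_pos.le, inv_inv, Real.rpow_add two_pos, Real.rpow_natCast,
    ← one_div (2 : ℝ), ← Real.sqrt_eq_rpow, Real.sqrt_mul two_pos.le]
  have hfac : ((2 * k)! : ℝ) = 2 ^ k * k ! * (2 * k - 1)‼ := by
    rw [← Nat.cast_ofNat (R := ℝ) (n := 2), ← Nat.cast_pow, ← Nat.cast_mul, ← Nat.cast_mul,
      ← Nat.doubleFactorial_two_mul, Nat.cast_inj]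
    cases k with
    | zero => rfl
    | succ k => exact Nat.factorial_eq_mul_doubleFactorial (2 * k + 1)
  rw [hfac]
  have : √(2:ℝ) ≠ 0 := by positivity
  have : √Real.pi ≠ 0 := by positivity
  field_simp

/-- The even moments of a standard Gaussian count pairings. -/
lemma integral_pow_gaussianReal {E : Type*} [Fintype E] [DecidableEq E]
    (hE : Even (Fintype.card E)) :
    ∫ x, x ^ Fintype.card E ∂(gaussianReal 0 1) = #(pairings E) := by
  obtain ⟨k, hk⟩ := hE.two_dvd
  rw [hk, integral_pow_two_mul_gaussianReal, ← card_pairings_even hk]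
  push_cast
  field_simp

/-- A pairing that preserves `f` restricts to each fibre, and pairings of the fibres glue. -/
lemma prod_card_pairings_fiber {E C : Type*} [Fintype E] [DecidableEq E] [Fintype C]
    [DecidableEq C] (f : E → C) :
    ∏ c, #(pairings {e // f e = c}) = #{σ ∈ pairings E | ∀ e, f (σ e) = f e} := by
  simp_rw [← Fintype.card_coe]
  rw [← Fintype.card_pi]
  symm
  refine Fintype.card_congr (Equiv.ofBijective (fun σ c => ⟨σ.1.subtypePerm (fun e => ?_), ?_⟩) ⟨?_, ?_⟩)
  · have := (mem_filter.1 σ.2).2 e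
    rw [this]
  · obtain ⟨h1, h2⟩ := mem_pairings.1 (mem_filter.1 σ.2).1
    rw [mem_pairings]
    refine ⟨fun x => Subtype.ext ?_, fun x hx => h2 x.1 ?_⟩
    · simp [h1]
    · simpa using congrArg Subtype.val hx
  · intro σ τ h
    ext e
    have := congrArg (fun ρ => (ρ.1 ⟨e, rfl⟩).1) (congrFun h (f e))
    simpa using this
  · intro τ
    have key : ∀ c (e : {e // f e = c}), ((τ (f e.1)).1 ⟨e.1, rfl⟩).1 = ((τ c).1 e).1 := by
      rintro _ ⟨e, rfl⟩
      rfl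
    have hf : ∀ e, f ((τ (f e)).1 ⟨e, rfl⟩).1 = f e := fun e => ((τ (f e)).1 ⟨e, rfl⟩).2
    have hinv : Function.Involutive fun e => ((τ (f e)).1 ⟨e, rfl⟩).1 := by
      intro e
      have := key (f e) ((τ (f e)).1 ⟨e, rfl⟩)
      simp only at this ⊢
      rw [this, (mem_pairings.1 (τ (f e)).2).1]
    refine ⟨⟨hinv.toPerm, ?_⟩, ?_⟩
    · rw [mem_filter, mem_pairings]
      refine ⟨⟨hinv, fun x hx => (mem_pairings.1 (τ (f x)).2).2 ⟨x, rfl⟩ (Subtype.ext hx)⟩, hf⟩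
    · ext c e
      exact key c e

/-! ### Expected products of entries. -/

section EntryMoments

variable {n m : ℕ} {Ω : Type*} [MeasurableSpace Ω] {μ : Measure Ω}

lemma integral_odd_pow_eq_zero {ζ : Ω → ℝ} (hm : AEMeasurable ζ μ)
    (hs : μ.map (fun ω => -ζ ω) = μ.map ζ) {k : ℕ} (hk : Odd k) : ∫ ω, ζ ω ^ k ∂μ = 0 := by
  have h1 : ∫ x, x ^ k ∂(μ.map ζ) = ∫ ω, ζ ω ^ k ∂μ := integral_map hm (by fun_prop)
  have h2 : ∫ x, x ^ k ∂(μ.map fun ω => -ζ ω) = ∫ ω, (-ζ ω) ^ k ∂μ :=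
    integral_map hm.neg (by fun_prop)
  rw [hs, h1] at h2
  simp_rw [hk.neg_pow, integral_neg] at h2
  linarith

lemma memLp_of_integrable_even_pow [IsFiniteMeasure μ] {ζ : Ω → ℝ} (hm : AEMeasurable ζ μ)
    (hi : ∀ k : ℕ, Integrable (fun ω => ζ ω ^ (2 * k)) μ) (N : ℕ) : MemLp ζ N μ := by
  rcases Nat.eq_zero_or_pos N with rfl | hN
  · simpa using hm.aestronglyMeasurable
  have : MemLp ζ ((2 * N : ℕ) : ENNReal) μ := by
    rw [← integrable_norm_rpow_iff hm.aestronglyMeasurable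
      (by simpa using hN.ne') (ENNReal.natCast_ne_top _)]
    refine (hi N).congr (.of_forall fun ω => ?_)
    simp only [ENNReal.toReal_natCast, Real.rpow_natCast]
    rw [pow_mul, pow_mul, Real.norm_eq_abs, sq_abs]
  exact this.mono_exponent (by exact_mod_cast (by omega : N ≤ 2 * N))

namespace IsIndependentEntryModel

variable {b : Matrix (Fin n) (Fin m) ℝ} {ξ : Fin n → Fin m → Ω → ℝ}
  {X : Ω → Matrix (Fin n) (Fin m) ℝ}

lemma prod_entry_eq (hX : IsIndependentEntryModel μ b ξ X) {E : Type*} [Fintype E]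
    (f : E → Fin n × Fin m) (ω : Ω) :
    ∏ e, X ω (f e).1 (f e).2 = (∏ e, b (f e).1 (f e).2) * ∏ e, ξ (f e).1 (f e).2 ω := by
  simp_rw [hX.entry_eq, prod_mul_distrib]

lemma integrable_prod_entry [IsProbabilityMeasure μ] (hX : IsIndependentEntryModel μ b ξ X)
    {E : Type*} [Fintype E] (f : E → Fin n × Fin m) : Integrable (fun ω => ∏ e, X ω (f e).1 (f e).2) μ := by
  simp_rw [hX.prod_entry_eq]
  refine Integrable.const_mul ?_ _
  rw [← memLp_one_iff_integrable]
  -- Hölder with every factor in `L^|E|`. The reciprocal exponents sum to 1, or to 0 if `E` is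
  -- empty, so only an inequality is claimed.
  refine (MemLp.prod' (p := fun _ => (Fintype.card E : ENNReal)) fun e _ =>
    memLp_of_integrable_even_pow (hX.aemeasurable _ _) (hX.moment_integrable _ _) _).mono_exponent ?_
  rw [sum_const, card_univ, nsmul_eq_mul, ENNReal.le_inv_iff_le_inv, inv_one]
  exact ENNReal.mul_inv_le_one _

lemma integral_prod_entry (hX : IsIndependentEntryModel μ b ξ X) {E : Type*} [Fintype E]
    (f : E → Fin n × Fin m) :
    ∫ ω, ∏ e, X ω (f e).1 (f e).2 ∂μ =
      (∏ e, b (f e).1 (f e).2) *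
        ∏ c, ∫ ω, ξ c.1 c.2 ω ^ Fintype.card {e // f e = c} ∂μ := by
  simp_rw [hX.prod_entry_eq]
  rw [integral_const_mul]
  congr 1
  rw [← hX.indep.integral_fun_prod_comp (f := fun c x => x ^ Fintype.card {e // f e = c})
    (fun q => hX.aemeasurable q.1 q.2) (fun _ => by fun_prop)]
  congr 1 with ω
  rw [← prod_fiberwise univ f]
  refine prod_congr rfl fun c _ => ?_
  rw [Fintype.card_subtype, ← prod_const]
  exact prod_congr rfl fun e he => by rw [(mem_filter.1 he).2]

lemma integral_prod_entry_le (hX : IsIndependentEntryModel μ b ξ X) {E : Type*} [Fintype E]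
    [DecidableEq E] (f : E → Fin n × Fin m) :
    ∫ ω, ∏ e, X ω (f e).1 (f e).2 ∂μ ≤
      (∏ e, b (f e).1 (f e).2) * #{σ ∈ pairings E | ∀ e, f (σ e) = f e} := by
  rw [hX.integral_prod_entry, ← prod_card_pairings_fiber, Nat.cast_prod]
  refine mul_le_mul_of_nonneg_left ?_ (prod_nonneg fun e _ => hX.scalar_nonneg _ _)
  -- Comparing products factor by factor also needs each moment to be nonnegative: even ones are,
  -- odd ones vanish.
  have key : ∀ c : Fin n × Fin m, 0 ≤ ∫ ω, ξ c.1 c.2 ω ^ Fintype.card {e // f e = c} ∂μ ∧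
      ∫ ω, ξ c.1 c.2 ω ^ Fintype.card {e // f e = c} ∂μ ≤ #(pairings {e // f e = c}) := by
    intro c
    rcases Nat.even_or_odd (Fintype.card {e // f e = c}) with h | h
    · refine ⟨integral_nonneg fun ω => h.pow_nonneg _, ?_⟩
      rw [← integral_pow_gaussianReal h]
      obtain ⟨k, hk⟩ := h.two_dvd
      rw [hk]
      exact hX.moment_le _ _ _
    · rw [integral_odd_pow_eq_zero (hX.aemeasurable _ _) (hX.symm_law _ _) h]
      simp
  exact prod_le_prod (fun c _ => (key c).1) fun c _ => (key c).2

end IsIndependentEntryModel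

namespace IsStandardGaussianMatrix

variable {Y : Ω → Matrix (Fin n) (Fin m) ℝ}

lemma isIndependentEntryModel (hY : IsStandardGaussianMatrix μ Y) :
    IsIndependentEntryModel μ (fun _ _ => 1) (fun i j ω => Y ω i j) Y where
  entry_eq _ _ _ := (one_mul _).symm
  scalar_nonneg _ _ := zero_le_one
  aemeasurable i j := (hY.law i j).aemeasurable
  indep := hY.indep
  symm_law i j := by
    have := (gaussianReal_neg (hY.law i j)).map_eq
    rw [neg_zero, ← (hY.law i j).map_eq] at this
    exact this
  moment_integrable i j k := by
    have : Integrable (fun x : ℝ => x ^ (2 * k)) (μ.map fun ω => Y ω i j) := by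
      rw [(hY.law i j).map_eq]
      refine (memLp_id_gaussianReal' _ (ENNReal.natCast_ne_top (2 * k))).integrable_norm_pow'.congr
        (.of_forall fun x => ?_)
      simp only [id]
      rw [pow_mul, pow_mul, Real.norm_eq_abs, sq_abs]
    exact this.comp_aemeasurable (hY.law i j).aemeasurable
  moment_le i j k := by
    rw [← (hY.law i j).map_eq, integral_map (hY.law i j).aemeasurable (by fun_prop)]

lemma integral_prod_entry [IsProbabilityMeasure μ] (hY : IsStandardGaussianMatrix μ Y)
    {E : Type*} [Fintype E] [DecidableEq E] (f : E → Fin n × Fin m) :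
    ∫ ω, ∏ e, Y ω (f e).1 (f e).2 ∂μ = #{σ ∈ pairings E | ∀ e, f (σ e) = f e} := by
  have hX := hY.isIndependentEntryModel
  rw [hX.integral_prod_entry, ← prod_card_pairings_fiber, Nat.cast_prod, prod_const_one, one_mul]
  refine prod_congr rfl fun c _ => ?_
  rcases Nat.even_or_odd (Fintype.card {e // f e = c}) with h | h
  · rw [← integral_pow_gaussianReal h, ← (hY.law c.1 c.2).map_eq,
      integral_map (hY.law _ _).aemeasurable (by fun_prop)]
  · rw [integral_odd_pow_eq_zero (hX.aemeasurable _ _) (hX.symm_law _ _) h, card_pairings_odd h,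
      Nat.cast_zero]

end IsStandardGaussianMatrix

end EntryMoments

/-! ### Traces as sums over closed walks. -/

lemma pow_apply_eq_sum_walks {n : ℕ} (M : Matrix (Fin n) (Fin n) ℝ) (p : ℕ) (i i' : Fin n) :
    (M ^ p) i i' = ∑ w : Fin (p + 1) → Fin n,
      if w 0 = i ∧ w (Fin.last p) = i' then ∏ k : Fin p, M (w k.castSucc) (w k.succ) else 0 := by
  induction p generalizing i with
  | zero =>
    rw [← (Equiv.funUnique (Fin 1) (Fin n)).symm.sum_comp]
    simp [Matrix.one_apply, ite_and]
  | succ p ih =>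
    rw [pow_succ', Matrix.mul_apply, ← (Fin.consEquiv (fun _ : Fin (p + 2) => Fin n)).sum_comp,
      Fintype.sum_prod_type, sum_comm]
    simp_rw [ih, mul_sum]
    rw [sum_comm]
    refine sum_congr rfl fun w _ => ?_
    simp only [Fin.consEquiv_apply, Fin.cons_zero, ← Fin.succ_last, Fin.cons_succ,
      Fin.prod_univ_succ (n := p), Fin.castSucc_zero, ← Fin.succ_castSucc]
    by_cases h : w (Fin.last p) = i' <;> simp [h]

/-- The row index visited at the step `e` of a closed walk that alternates between rows and
columns: the `k`-th column is entered from the `k`-th row and left to the `(k+1)`-st one. -/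
def rowStep {p : ℕ} (e : Fin p × Bool) : Fin (p + 1) :=
  if e.2 then e.1.succ else e.1.castSucc

lemma trace_pow_mul_conjTranspose {n m : ℕ} (A : Matrix (Fin n) (Fin m) ℝ) (p : ℕ) :
    ((A * Aᴴ) ^ p).trace = ∑ w : Fin (p + 1) → Fin n, ∑ j : Fin p → Fin m,
      if w 0 = w (Fin.last p) then ∏ e : Fin p × Bool, A (w (rowStep e)) (j e.1) else 0 := by
  simp only [Matrix.trace, Matrix.diag_apply, pow_apply_eq_sum_walks]
  rw [sum_comm]
  refine sum_congr rfl fun w _ => ?_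
  simp only [ite_and, sum_ite_eq, mem_univ, if_true, eq_comm (a := w (Fin.last p))]
  split_ifs with h
  · simp_rw [Fintype.prod_prod_type, Fintype.prod_bool, Matrix.mul_apply,
      Matrix.conjTranspose_apply]
    rw [prod_univ_sum, Fintype.piFinset_univ]
    refine sum_congr rfl fun j _ => prod_congr rfl fun k _ => ?_
    simp [rowStep, mul_comm]
  · simp

/-! ### Spanning-tree bound for weighted colourings. -/

lemma sum_sum_update {V C : Type*} [Fintype V] [DecidableEq V] [Fintype C] (v : V)
    (F : (V → C) → ℝ) :
    ∑ w : V → C, ∑ x : C, F (Function.update w v x) = Fintype.card C * ∑ w, F w := by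
  -- Exchanging `w v` with the extra colour permutes the pairs `(w, x)`.
  have hinv : Function.Involutive
      fun q : (V → C) × C => (Function.update q.1 v q.2, q.1 v) := by
    rintro ⟨w, x⟩
    simp
  rw [← Fintype.sum_prod_type', ← Equiv.sum_comp hinv.toPerm, Fintype.sum_prod_type, mul_sum]
  refine sum_congr rfl fun w _ => ?_
  simp

/-- Summing out a coordinate `v` on which the weight `G` does not depend. -/
lemma sum_mul_coord_le {V C α : Type*} [Fintype V] [DecidableEq V] [Fintype C] [Fintype α]
    (v : V) (G : (V → C) → α → ℝ) (hG : ∀ w a, 0 ≤ G w a)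
    (hinv : ∀ w x a, G (Function.update w v x) a = G w a) (H : C → α → ℝ) (d : ℝ)
    (hH : ∀ a, ∑ x, H x a ≤ d) :
    (∑ w, ∑ a, G w a * H (w v) a) * Fintype.card C ≤ d * ∑ w, ∑ a, G w a := by
  rw [mul_comm, ← sum_sum_update v, mul_sum]
  refine sum_le_sum fun w _ => ?_
  rw [sum_comm, mul_sum]
  refine sum_le_sum fun a _ => ?_
  simp_rw [hinv, Function.update_self, ← mul_sum]
  rw [mul_comm]
  exact mul_le_mul_of_nonneg_right (hH a) (hG w a)

section TreeBound

variable {V₁ V₂ C₁ C₂ E : Type*} [Fintype V₁] [DecidableEq V₁] [Fintype V₂] [DecidableEq V₂]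
  [Fintype C₁] [Fintype C₂]

/-- There is a set `T` of edges inside the vertex set `(S₁, S₂)` that contains no two paired edges,
such that the weighted number of colourings is controlled as for a spanning tree. -/
def TreeBound (r : E → V₁) (c : E → V₂) (π : E → E) (B : C₁ → C₂ → ℝ) (d₁ d₂ K : ℝ)
    (S₁ : Finset V₁) (S₂ : Finset V₂) : Prop :=
  ∃ T : Finset E, (∀ e ∈ T, r e ∈ S₁ ∧ c e ∈ S₂) ∧ (∀ e ∈ T, π e ∉ T) ∧
    (∑ w : V₁ → C₁, ∑ j : V₂ → C₂, ∏ e ∈ T, B (w (r e)) (j (c e))) *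
      ((Fintype.card C₁ : ℝ) ^ #S₁ * (Fintype.card C₂ : ℝ) ^ #S₂) ≤ K * (d₁ ^ #S₁ * d₂ ^ #S₂)

variable {r : E → V₁} {c : E → V₂} {π : E → E} {B : C₁ → C₂ → ℝ} {d₁ d₂ K : ℝ}
  {S₁ : Finset V₁} {S₂ : Finset V₂}

lemma TreeBound.swap (h : TreeBound r c π B d₁ d₂ K S₁ S₂) :
    TreeBound c r π (fun y x => B x y) d₂ d₁ K S₂ S₁ := by
  obtain ⟨T, h1, h2, h3⟩ := h
  refine ⟨T, fun e he => (h1 e he).symm, h2, ?_⟩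
  rwa [sum_comm, mul_comm (_ ^ #S₂), mul_comm (d₂ ^ _)]

variable [DecidableEq E]

/-- A new row vertex hangs as a leaf on `e₀`; summing out its colour gives at most `d₁`, where a
free colour would give `|C₁|`. The partner of `e₀` has the same row vertex, so it cannot already be
in the tree. -/
lemma TreeBound.insert_left (h : TreeBound r c π B d₁ d₂ K S₁ S₂)
    (hr : ∀ e, r (π e) = r e) (hfix : ∀ e, π e ≠ e)
    (hB : ∀ x y, 0 ≤ B x y) (hd : 0 ≤ d₁) (hsum : ∀ y, ∑ x, B x y ≤ d₁) {e₀ : E}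
    (he₀ : c e₀ ∈ S₂) : TreeBound r c π B d₁ d₂ K (insert (r e₀) S₁) S₂ := by
  by_cases hmem : r e₀ ∈ S₁
  · rwa [insert_eq_of_mem hmem]
  obtain ⟨T, h1, h2, h3⟩ := h
  have hT : ∀ e ∈ T, r e ≠ r e₀ := fun e he h => hmem (h ▸ (h1 e he).1)
  have heT : e₀ ∉ T := fun h => hT _ h rfl
  refine ⟨insert e₀ T, ?_, ?_, ?_⟩
  · intro e he
    rcases mem_insert.1 he with rfl | he
    · exact ⟨mem_insert_self _ _, he₀⟩
    · exact ⟨mem_insert_of_mem (h1 e he).1, (h1 e he).2⟩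
  · intro e he hπ
    rcases mem_insert.1 he with rfl | he <;> rcases mem_insert.1 hπ with hπ | hπ
    · exact hfix _ hπ
    · exact hT _ hπ (hr _)
    · exact hT e he (by rw [← hr, hπ])
    · exact h2 e he hπ
  · have key := sum_mul_coord_le (r e₀)
      (fun (w : V₁ → C₁) (j : V₂ → C₂) => ∏ e ∈ T, B (w (r e)) (j (c e)))
      (fun w j => prod_nonneg fun e _ => hB _ _)
      (fun w x j => prod_congr rfl fun e he => by rw [Function.update_of_ne (hT e he)])
      (fun x j => B x (j (c e₀))) d₁ (fun j => hsum _)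
    simp_rw [prod_insert heT, card_insert_of_notMem hmem, pow_succ, mul_comm (B _ (_ : C₂))]
    calc _ = (∑ w : V₁ → C₁, ∑ j : V₂ → C₂,
          (∏ e ∈ T, B (w (r e)) (j (c e))) * B (w (r e₀)) (j (c e₀))) * Fintype.card C₁ *
          ((Fintype.card C₁ : ℝ) ^ #S₁ * (Fintype.card C₂ : ℝ) ^ #S₂) := by ring
      _ ≤ _ := mul_le_mul_of_nonneg_right key (by positivity)
      _ = d₁ * ((∑ w : V₁ → C₁, ∑ j : V₂ → C₂, ∏ e ∈ T, B (w (r e)) (j (c e))) *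
          ((Fintype.card C₁ : ℝ) ^ #S₁ * (Fintype.card C₂ : ℝ) ^ #S₂)) := by ring
      _ ≤ _ := mul_le_mul_of_nonneg_left h3 hd
      _ = _ := by ring

lemma TreeBound.insert_right (h : TreeBound r c π B d₁ d₂ K S₁ S₂)
    (hc : ∀ e, c (π e) = c e) (hfix : ∀ e, π e ≠ e)
    (hB : ∀ x y, 0 ≤ B x y) (hd : 0 ≤ d₂) (hsum : ∀ x, ∑ y, B x y ≤ d₂) {e₀ : E}
    (he₀ : r e₀ ∈ S₁) : TreeBound r c π B d₁ d₂ K S₁ (insert (c e₀) S₂) :=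
  (h.swap.insert_left hc hfix (fun x y => hB y x) hd hsum he₀).swap

/-- A product over all edges of weights in `[0, 1]` that agree on paired edges is at most the
product of the squared weights over a set without paired edges. -/
lemma prod_le_prod_sq [Fintype E] (hπ : Function.Injective π) {T : Finset E}
    (hT : ∀ e ∈ T, π e ∉ T) {β : E → ℝ} (h0 : ∀ e, 0 ≤ β e) (h1 : ∀ e, β e ≤ 1)
    (hβ : ∀ e, β (π e) = β e) : ∏ e, β e ≤ ∏ e ∈ T, β e ^ 2 := by
  have hd : Disjoint T (T.image π) := by
    rw [disjoint_right]
    intro e he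
    obtain ⟨e', he', rfl⟩ := mem_image.1 he
    exact hT e' he'
  have : ∏ e ∈ T, β e ^ 2 = ∏ e ∈ T ∪ T.image π, β e := by
    rw [prod_union hd, prod_image hπ.injOn, ← prod_mul_distrib]
    exact prod_congr rfl fun e _ => by rw [hβ, pow_two]
  rw [this, ← prod_mul_prod_compl (T ∪ T.image π)]
  exact mul_le_of_le_one_right (prod_nonneg fun e _ => h0 e)
    (prod_le_one (fun e _ => h0 e) fun e _ => h1 e)

end TreeBound

/-- The weighted number of colourings of the vertices of a closed walk, whose edges are
identified in pairs, is at most what it is for the all-ones matrix, up to normalization. -/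
lemma sum_walk_colourings_le {V₁ V₂ : Type*} [Fintype V₁] [DecidableEq V₁] [Fintype V₂]
    [DecidableEq V₂] {n m p : ℕ}
    (hn : 0 < n) (hm : 0 < m) {b : Fin n → Fin m → ℝ} {d₁ d₂ : ℝ}
    (hb0 : ∀ i j, 0 ≤ b i j) (hb1 : ∀ i j, b i j ≤ 1) (hd₁ : 0 < d₁) (hd₂ : 0 ≤ d₂)
    (hcol : ∀ j, ∑ i, b i j ^ 2 ≤ d₁) (hrow : ∀ i, ∑ j, b i j ^ 2 ≤ d₂)
    {u : Fin (p + 1) → V₁} {v : Fin p → V₂} (hu : Function.Surjective u)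
    (hv : Function.Surjective v) {π : Perm (Fin p × Bool)} (hπ : π ∈ pairings (Fin p × Bool))
    (hur : ∀ e, u (rowStep (π e)) = u (rowStep e)) (hvr : ∀ e, v (π e).1 = v e.1) :
    ∑ w : V₁ → Fin n, ∑ j : V₂ → Fin m,
        ∏ e : Fin p × Bool, b (w (u (rowStep e))) (j (v e.1)) ≤
      n / d₁ * (d₁ ^ Fintype.card V₁ * d₂ ^ Fintype.card V₂) := by
  obtain ⟨-, hfix⟩ := mem_pairings.1 hπ
  -- All colourings are summed, so unvisited vertices contribute free factors `n` or `m`. The ratio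
  -- `n / d₁` is the root: its colour is free, yet it is counted in the power of `d₁`.
  let K : ℝ := n / d₁ * ((n : ℝ) ^ Fintype.card V₁ * (m : ℝ) ^ Fintype.card V₂)
  have key : ∀ k (hk : k ≤ p), TreeBound (fun e => u (rowStep e)) (fun e => v e.1) π
      (fun x y => b x y ^ 2) d₁ d₂ K
      ((univ.filter fun i : Fin (p + 1) => i.1 ≤ k).image u)
      ((univ.filter fun i : Fin p => i.1 < k).image v) := by
    intro k
    induction k with
    | zero =>
      intro _
      have h1 : (univ.filter fun i : Fin (p + 1) => i.1 ≤ 0) = {0} := by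
        ext i; simp
      rw [h1]
      refine ⟨∅, by simp, by simp, ?_⟩
      simp only [K, prod_empty, sum_const, card_univ, Fintype.card_fun, Fintype.card_fin,
        image_singleton, card_singleton, not_lt_zero, filter_false, image_empty, card_empty,
        nsmul_eq_mul, pow_one, pow_zero, mul_one, Nat.cast_pow]
      field_simp
      exact le_refl _
    | succ k ih =>
      intro hk
      -- Walk step `k` first reaches column `k` from row `k`, then row `k + 1` from that column.
      have hmem : u (rowStep ((⟨k, hk⟩ : Fin p), false)) ∈
          (univ.filter fun i : Fin (p + 1) => i.1 ≤ k).image u :=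
        mem_image_of_mem _ (by simp [rowStep])
      have h := (ih (by omega)).insert_right hvr hfix (fun _ _ => sq_nonneg _) hd₂ hrow hmem
      have h' := h.insert_left hur hfix (fun _ _ => sq_nonneg _) hd₁.le hcol
        (e₀ := (⟨k, hk⟩, true)) (mem_insert_self _ _)
      simp only [← image_insert] at h'
      convert h' using 2
      · ext i
        simp [rowStep, Fin.ext_iff]
        omega
      · ext i
        simp [Fin.ext_iff]
        omega
  obtain ⟨T, -, hT, h⟩ := key p le_rfl
  have e1 : (univ.filter fun i : Fin (p + 1) => i.1 ≤ p).image u = univ := by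
    rw [filter_true_of_mem (fun i _ => by omega), image_univ_of_surjective hu]
  have e2 : (univ.filter fun i : Fin p => i.1 < p).image v = univ := by
    rw [filter_true_of_mem (fun i _ => by omega), image_univ_of_surjective hv]
  rw [e1, e2, card_univ, card_univ, Fintype.card_fin, Fintype.card_fin] at h
  have hpos : (0 : ℝ) < (n : ℝ) ^ Fintype.card V₁ * (m : ℝ) ^ Fintype.card V₂ := by positivity
  refine le_trans (sum_le_sum fun w _ => sum_le_sum fun j _ => prod_le_prod_sq π.injective hT
    (fun _ => hb0 _ _) (fun _ => hb1 _ _) (fun e => by rw [hur, hvr])) ?_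
  refine le_of_mul_le_mul_right (h.trans_eq ?_) hpos
  simp only [K]
  ring

/-! ### Gluing the walk along a pairing. -/

/-- Summing over the functions that respect a relation is summing over its quotient. -/
lemma sum_respecting_eq_sum_quot {A C : Type*} [Fintype A] [DecidableEq A] [Fintype C]
    (rel : A → A → Prop) [Fintype (Quot rel)] [DecidableEq (Quot rel)]
    [DecidablePred fun w : A → C => ∀ x y, rel x y → w x = w y] (F : (A → C) → ℝ) :
    ∑ w : A → C, (if ∀ x y, rel x y → w x = w y then F w else 0) =
      ∑ w : Quot rel → C, F fun x => w (Quot.mk rel x) := by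
  rw [← sum_filter]
  refine sum_bij' (fun w hw => Quot.lift w (mem_filter.1 hw).2) (fun w _ x => w (Quot.mk rel x))
    (fun _ _ => mem_univ _) (fun w _ => ?_) (fun _ _ => rfl) (fun w _ => ?_) (fun _ _ => rfl)
  · exact mem_filter.2 ⟨mem_univ _, fun x y h => congrArg w (Quot.sound h)⟩
  · funext q
    induction q using Quot.ind
    rfl

/-- The relation on row positions of a closed walk generated by closing up and by `π`. -/
def RowRel {p : ℕ} (π : Perm (Fin p × Bool)) (x y : Fin (p + 1)) : Prop :=
  (x = 0 ∧ y = Fin.last p) ∨ ∃ e, x = rowStep (π e) ∧ y = rowStep e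

/-- The relation on column positions of a closed walk generated by `π`. -/
def ColRel {p : ℕ} (π : Perm (Fin p × Bool)) (x y : Fin p) : Prop :=
  ∃ e, x = (π e).1 ∧ y = e.1

open Classical in
/-- The contribution of the pairing `π` to the `p`-th trace moment. -/
noncomputable def pairingSum {n m p : ℕ} (b : Fin n → Fin m → ℝ)
    (π : Perm (Fin p × Bool)) : ℝ :=
  ∑ w : Fin (p + 1) → Fin n, ∑ j : Fin p → Fin m,
    if w 0 = w (Fin.last p) ∧ ∀ e, (w (rowStep (π e)), j (π e).1) = (w (rowStep e), j e.1)
    then ∏ e : Fin p × Bool, b (w (rowStep e)) (j e.1) else 0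

open Classical in
lemma pairingSum_eq_sum_quot {n m p : ℕ} (b : Fin n → Fin m → ℝ)
    (π : Perm (Fin p × Bool)) [Fintype (Quot (RowRel π))] [Fintype (Quot (ColRel π))] :
    pairingSum b π = ∑ w : Quot (RowRel π) → Fin n, ∑ j : Quot (ColRel π) → Fin m,
      ∏ e : Fin p × Bool, b (w (Quot.mk _ (rowStep e))) (j (Quot.mk _ e.1)) := by
  rw [← sum_respecting_eq_sum_quot (RowRel π) fun w => ∑ j : Quot (ColRel π) → Fin m,
      ∏ e : Fin p × Bool, b (w (rowStep e)) (j (Quot.mk _ e.1))]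
  refine sum_congr rfl fun w _ => ?_
  rw [← sum_respecting_eq_sum_quot (ColRel π) fun j =>
      ∏ e : Fin p × Bool, b (w (rowStep e)) (j e.1)]
  have hw : (∀ x y, RowRel π x y → w x = w y) ↔
      w 0 = w (Fin.last p) ∧ ∀ e, w (rowStep (π e)) = w (rowStep e) := by
    constructor
    · exact fun h => ⟨h _ _ (.inl ⟨rfl, rfl⟩), fun e => h _ _ (.inr ⟨e, rfl, rfl⟩)⟩
    · rintro ⟨h1, h2⟩ x y (⟨rfl, rfl⟩ | ⟨e, rfl, rfl⟩)
      exacts [h1, h2 e]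
  have hj : ∀ j : Fin p → Fin m,
      (∀ x y, ColRel π x y → j x = j y) ↔ ∀ e, j (π e).1 = j e.1 := by
    intro j
    constructor
    · exact fun h e => h _ _ ⟨e, rfl, rfl⟩
    · rintro h x y ⟨e, rfl, rfl⟩
      exact h e
  simp only [hw, hj, Prod.mk.injEq, forall_and, ← and_assoc]
  split_ifs with h
  · simp only [h, true_and, and_self, implies_true]
  · simp only [h, false_and, if_false, sum_const_zero]

lemma pairingSum_le {n m p d₁ d₂ : ℕ} (hn : 0 < n) (hm : 0 < m) (hd : 0 < d₁)
    {b : Fin n → Fin m → ℝ} (hb0 : ∀ i j, 0 ≤ b i j) (hb1 : ∀ i j, b i j ≤ 1)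
    (hcol : ∀ j, ∑ i, b i j ^ 2 ≤ d₁) (hrow : ∀ i, ∑ j, b i j ^ 2 ≤ d₂)
    {π : Perm (Fin p × Bool)} (hπ : π ∈ pairings (Fin p × Bool)) :
    pairingSum b π ≤
      n / d₁ * pairingSum (fun (_ : Fin d₁) (_ : Fin d₂) => (1 : ℝ)) π := by
  have : Fintype (Quot (RowRel π)) := Fintype.ofFinite _
  have : Fintype (Quot (ColRel π)) := Fintype.ofFinite _
  classical
  rw [pairingSum_eq_sum_quot, pairingSum_eq_sum_quot]
  simp only [prod_const_one, sum_const, card_univ, Fintype.card_fun, Fintype.card_fin,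
    nsmul_eq_mul, mul_one, Nat.cast_pow]
  exact sum_walk_colourings_le hn hm hb0 hb1 (by exact_mod_cast hd) d₂.cast_nonneg hcol hrow
    Quot.mk_surjective Quot.mk_surjective hπ
    (fun e => Quot.sound (.inr ⟨e, rfl, rfl⟩)) (fun e => Quot.sound ⟨e, rfl, rfl⟩)

/-! ### Trace moments as sums over pairings. -/

section Moments

variable {n m : ℕ} {Ω : Type*} [MeasurableSpace Ω] {μ : Measure Ω}

lemma integrable_trace_pow {X : Ω → Matrix (Fin n) (Fin m) ℝ} {p : ℕ}
    (hX : ∀ f : Fin p × Bool → Fin n × Fin m,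
      Integrable (fun ω => ∏ e, X ω (f e).1 (f e).2) μ) :
    Integrable (fun ω => ((X ω * (X ω)ᴴ) ^ p).trace) μ := by
  simp_rw [trace_pow_mul_conjTranspose]
  refine integrable_finsetSum _ fun w _ => integrable_finsetSum _ fun j _ => ?_
  split_ifs
  · exact hX fun e => (w (rowStep e), j e.1)
  · exact integrable_zero _ _ _

lemma integral_trace_pow {X : Ω → Matrix (Fin n) (Fin m) ℝ} {p : ℕ}
    (hX : ∀ f : Fin p × Bool → Fin n × Fin m,
      Integrable (fun ω => ∏ e, X ω (f e).1 (f e).2) μ) :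
    ∫ ω, ((X ω * (X ω)ᴴ) ^ p).trace ∂μ =
      ∑ w : Fin (p + 1) → Fin n, ∑ j : Fin p → Fin m,
        if w 0 = w (Fin.last p) then
          ∫ ω, ∏ e : Fin p × Bool, X ω (w (rowStep e)) (j e.1) ∂μ else 0 := by
  have hi : ∀ (w : Fin (p + 1) → Fin n) (j : Fin p → Fin m), Integrable (fun ω =>
      if w 0 = w (Fin.last p) then
        ∏ e : Fin p × Bool, X ω (w (rowStep e)) (j e.1) else 0) μ := by
    intro w j
    split_ifs
    · exact hX fun e => (w (rowStep e), j e.1)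
    · exact integrable_zero _ _ _
  simp_rw [trace_pow_mul_conjTranspose]
  rw [integral_finsetSum _ fun w _ => integrable_finsetSum _ fun j _ => hi w j]
  refine sum_congr rfl fun w _ => ?_
  rw [integral_finsetSum _ fun j _ => hi w j]
  refine sum_congr rfl fun j _ => ?_
  split_ifs <;> simp

lemma sum_walks_card_pairings (b : Fin n → Fin m → ℝ) (p : ℕ) :
    (∑ w : Fin (p + 1) → Fin n, ∑ j : Fin p → Fin m,
      if w 0 = w (Fin.last p) then (∏ e : Fin p × Bool, b (w (rowStep e)) (j e.1)) *
        (#{π ∈ pairings (Fin p × Bool) |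
          ∀ e, (w (rowStep (π e)), j (π e).1) = (w (rowStep e), j e.1)} : ℝ) else 0) =
      ∑ π ∈ pairings (Fin p × Bool), pairingSum b π := by
  simp only [pairingSum]
  symm
  rw [sum_comm]
  refine sum_congr rfl fun w _ => ?_
  rw [sum_comm]
  refine sum_congr rfl fun j _ => ?_
  by_cases h : w 0 = w (Fin.last p)
  · simp only [h, true_and, if_true]
    rw [← sum_filter, sum_const, nsmul_eq_mul, mul_comm]
  · simp [h]

variable [IsProbabilityMeasure μ]

lemma IsIndependentEntryModel.integral_trace_pow_le {b : Matrix (Fin n) (Fin m) ℝ}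
    {ξ : Fin n → Fin m → Ω → ℝ} {X : Ω → Matrix (Fin n) (Fin m) ℝ}
    (hX : IsIndependentEntryModel μ b ξ X) (p : ℕ) :
    ∫ ω, ((X ω * (X ω)ᴴ) ^ p).trace ∂μ ≤ ∑ π ∈ pairings (Fin p × Bool), pairingSum b π := by
  rw [integral_trace_pow hX.integrable_prod_entry, ← sum_walks_card_pairings b]
  refine sum_le_sum fun w _ => sum_le_sum fun j _ => ?_
  split_ifs
  · exact hX.integral_prod_entry_le fun e : Fin p × Bool => (w (rowStep e), j e.1)
  · exact le_rfl

lemma IsStandardGaussianMatrix.integral_trace_pow {Y : Ω → Matrix (Fin n) (Fin m) ℝ}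
    (hY : IsStandardGaussianMatrix μ Y) (p : ℕ) :
    ∫ ω, ((Y ω * (Y ω)ᴴ) ^ p).trace ∂μ =
      ∑ π ∈ pairings (Fin p × Bool), pairingSum (fun (_ : Fin n) (_ : Fin m) => (1 : ℝ)) π := by
  rw [RectExtremum.integral_trace_pow hY.isIndependentEntryModel.integrable_prod_entry,
    ← sum_walks_card_pairings (fun (_ : Fin n) (_ : Fin m) => (1 : ℝ))]
  refine sum_congr rfl fun w _ => sum_congr rfl fun j _ => ?_
  rw [hY.integral_prod_entry fun e : Fin p × Bool => (w (rowStep e), j e.1), prod_const_one,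
    one_mul]

end Moments

end RectExtremum

theorem theorem4p1 {n m d₁ d₂ : ℕ}
    {Ω : Type*} [MeasurableSpace Ω] (μ : Measure Ω) [IsProbabilityMeasure μ]
    {Ω' : Type*} [MeasurableSpace Ω'] (ν : Measure Ω') [IsProbabilityMeasure ν]
    (b : Matrix (Fin n) (Fin m) ℝ) (ξ : Fin n → Fin m → Ω → ℝ)
    (X : Ω → Matrix (Fin n) (Fin m) ℝ) (Y : Ω' → Matrix (Fin d₁) (Fin d₂) ℝ)
    (hX : RectExtremum.IsIndependentEntryModel μ b ξ X)
    (hstar : RectExtremum.sigmaStarSq b = 1)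
    (h₁ : RectExtremum.sigmaOneSq b ≤ (d₁ : ℝ))
    (h₂ : RectExtremum.sigmaTwoSq b ≤ (d₂ : ℝ))
    (hY : RectExtremum.IsStandardGaussianMatrix ν Y) :
    ∀ p : ℕ,
      Integrable (fun ω => RectExtremum.normTrace ((X ω * (X ω)ᴴ) ^ p)) μ ∧
      Integrable (fun ω => RectExtremum.normTrace ((Y ω * (Y ω)ᴴ) ^ p)) ν ∧
      ∫ ω, RectExtremum.normTrace ((X ω * (X ω)ᴴ) ^ p) ∂μ ≤
        ∫ ω, RectExtremum.normTrace ((Y ω * (Y ω)ᴴ) ^ p) ∂ν := by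
  intro p
  simp only [RectExtremum.normTrace]
  refine ⟨(RectExtremum.integrable_trace_pow hX.integrable_prod_entry).const_mul _,
    (RectExtremum.integrable_trace_pow
      hY.isIndependentEntryModel.integrable_prod_entry).const_mul _, ?_⟩
  have hcol : ∀ j, ∑ i, b i j ^ 2 ≤ (d₁ : ℝ) := fun j =>
    (le_ciSup (f := fun j => ∑ i, b i j ^ 2) (Set.finite_range _).bddAbove j).trans h₁
  have hrow : ∀ i, ∑ j, b i j ^ 2 ≤ (d₂ : ℝ) := fun i =>
    (le_ciSup (f := fun i => ∑ j, b i j ^ 2) (Set.finite_range _).bddAbove i).trans h₂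
  have hb1 : ∀ i j, b i j ≤ 1 := fun i j => by
    have : b i j ^ 2 ≤ 1 := (le_ciSup (f := fun q : Fin n × Fin m => b q.1 q.2 ^ 2)
      (Set.finite_range _).bddAbove (i, j)).trans_eq hstar
    exact (sq_le_one_iff₀ (hX.scalar_nonneg i j)).1 this
  -- An empty index set would make the supremum 0, not 1.
  have hne : Nonempty (Fin n × Fin m) := by
    by_contra h
    rw [not_nonempty_iff] at h
    rw [RectExtremum.sigmaStarSq, Real.iSup_of_isEmpty] at hstar
    exact zero_ne_one hstar
  obtain ⟨⟨i, j⟩, hij⟩ := exists_eq_ciSup_of_finite (f := fun q : Fin n × Fin m => b q.1 q.2 ^ 2)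
  have hij1 : b i j ^ 2 = 1 := hij.trans hstar
  -- An entry of square 1 forces its column sum, hence `d₁`, to be positive.
  have hd : 0 < d₁ := by
    have : b i j ^ 2 ≤ ∑ i, b i j ^ 2 :=
      Finset.single_le_sum (f := fun i => b i j ^ 2) (fun _ _ => sq_nonneg _) (Finset.mem_univ i)
    have h1 : (0 : ℝ) < d₁ := by linarith [hcol j]
    exact_mod_cast h1
  have hn : 0 < n := i.pos
  rw [integral_const_mul, integral_const_mul, hY.integral_trace_pow]
  refine (mul_le_mul_of_nonneg_left ((hX.integral_trace_pow_le p).trans (Finset.sum_le_sum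
    fun π hπ => RectExtremum.pairingSum_le hn j.pos hd hX.scalar_nonneg hb1 hcol hrow hπ))
    (by positivity)).trans_eq ?_
  rw [← Finset.mul_sum]
  field_simp
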